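/- Let $m, n \ge 0$ be integers and let $M \subset \mathbf{P}^m$ be a projective variety in complex projective space of dimension $m$, i.e. the set of common zeros of a family of homogeneous polynomials in $m+1$ variables with complex coefficients (irreducibility is not required). A divisor on $M$ is the intersection of $M$ with a hyperplane of $\mathbf{P}^m$. Let $D_1, \dots, D_{2n+1}$ be divisors on $M$ such that $\bigcap_{j \in I} D_j = \emptyset$ for every index set $I \subset \{1, \dots, 2n+1\}$ with exactly $n+1$ elements. Then every holomorphic map $f : \mathbf{C} \to M$ that omits all these divisors, i.e. $f(\mathbf{C}) \cap D_j = \emptyset$ for $j = 1, \dots, 2n+1$, is constant. Here $f$ is called holomorphic if near every point of $\mathbf{C}$ it can be written as $f = (f_0 : \dots : f_m)$ with holomorphic functions $f_0, \dots, f_m$ without common zeros. -/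

import Mathlib

noncomputable section

namespace HolCurve

/-- Complex projective space of dimension `m`: lines through the origin in `ℂ^(m+1)`. -/
abbrev ProjSpace (m : ℕ) : Type := Projectivization ℂ (Fin (m + 1) → ℂ)

/-- The zero locus in `P^m` of a set of (homogeneous) polynomials in `m + 1` variables. For
homogeneous polynomials it does not depend on the choice of homogeneous coordinates, see
`mk_mem_zeroLocus`. -/
def zeroLocus {m : ℕ} (S : Set (MvPolynomial (Fin (m + 1)) ℂ)) : Set (ProjSpace m) :=
  {p | ∀ P ∈ S, MvPolynomial.eval p.rep P = 0}

/-- A projective variety in `P^m`: the set of common zeros of a family of homogeneous polynomials.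
It may be reducible. -/
def IsProjectiveVariety {m : ℕ} (M : Set (ProjSpace m)) : Prop :=
  ∃ S : Set (MvPolynomial (Fin (m + 1)) ℂ),
    (∀ P ∈ S, ∃ d : ℕ, P.IsHomogeneous d) ∧ M = zeroLocus S

/-- The hyperplane `{L = 0}` in `P^m`, for a nonzero linear form `L` on `ℂ^(m+1)`. It does not
depend on the choice of homogeneous coordinates, see `mk_mem_hyperplane`. -/
def hyperplane {m : ℕ} (L : Module.Dual ℂ (Fin (m + 1) → ℂ)) : Set (ProjSpace m) :=
  {p | L p.rep = 0}

/-- A divisor on `M`: the intersection of `M` with a hyperplane. -/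
def IsDivisorOn {m : ℕ} (M D : Set (ProjSpace m)) : Prop :=
  ∃ L : Module.Dual ℂ (Fin (m + 1) → ℂ), L ≠ 0 ∧ D = M ∩ hyperplane L

/-- `f : ℂ → P^m` is holomorphic: near every point it is given in homogeneous coordinates by
holomorphic functions without common zeros. -/
def IsHolomorphic {m : ℕ} (f : ℂ → ProjSpace m) : Prop :=
  ∀ z₀ : ℂ, ∃ U : Set ℂ, IsOpen U ∧ z₀ ∈ U ∧ ∃ F : ℂ → (Fin (m + 1) → ℂ),
    DifferentiableOn ℂ F U ∧
      ∀ z ∈ U, ∃ h : F z ≠ 0, f z = Projectivization.mk ℂ (F z) h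

theorem mk_mem_hyperplane {m : ℕ} (L : Module.Dual ℂ (Fin (m + 1) → ℂ))
    (v : Fin (m + 1) → ℂ) (hv : v ≠ 0) :
    Projectivization.mk ℂ v hv ∈ hyperplane L ↔ L v = 0 := by
  obtain ⟨a, ha⟩ := Projectivization.exists_smul_eq_mk_rep ℂ v hv
  change L _ = 0 ↔ _
  rw [← ha, Units.smul_def, map_smul, smul_eq_mul, mul_eq_zero]
  simp

theorem eval_smul_of_isHomogeneous {m d : ℕ} {P : MvPolynomial (Fin (m + 1)) ℂ}
    (hP : P.IsHomogeneous d) (a : ℂ) (v : Fin (m + 1) → ℂ) :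
    MvPolynomial.eval (a • v) P = a ^ d * MvPolynomial.eval v P := by
  rw [MvPolynomial.eval_eq, MvPolynomial.eval_eq, Finset.mul_sum]
  refine Finset.sum_congr rfl fun s hs => ?_
  have h : ∑ i, s i = d := by
    have h1 := hP (MvPolynomial.mem_support_iff.mp hs)
    rw [Finsupp.weight_apply, Finsupp.sum_fintype _ _ (by simp)] at h1
    simpa using h1
  have h3 : ∑ i ∈ s.support, s i = d := by
    rw [← h]
    exact Finset.sum_subset (Finset.subset_univ _) (by simp)
  simp only [Pi.smul_apply, smul_eq_mul, mul_pow, Finset.prod_mul_distrib,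
    Finset.prod_pow_eq_pow_sum, h3]
  ring

theorem mk_mem_zeroLocus {m : ℕ} (S : Set (MvPolynomial (Fin (m + 1)) ℂ))
    (hS : ∀ P ∈ S, ∃ d : ℕ, P.IsHomogeneous d) (v : Fin (m + 1) → ℂ) (hv : v ≠ 0) :
    Projectivization.mk ℂ v hv ∈ zeroLocus S ↔ ∀ P ∈ S, MvPolynomial.eval v P = 0 := by
  obtain ⟨a, ha⟩ := Projectivization.exists_smul_eq_mk_rep ℂ v hv
  refine forall₂_congr fun P hP => ?_
  obtain ⟨d, hd⟩ := hS P hP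
  rw [← ha, Units.smul_def, eval_smul_of_isHomogeneous hd, mul_eq_zero]
  simp

end HolCurve

end

/-!
Since every `n + 1` of the hyperplane forms `L j` have no common zero on `M`, compactness gives
`‖L k v‖ ≤ C * max_{j ∈ I} ‖L j v‖` on the cone over `M`, for each set `I` of `n + 1` indices
(`exists_norm_le_sum_norm`). As the curve omits the divisor of `L 0`, it has an entire lift `G` with
`L 0 ∘ G = 1`, and `L i ∘ G = exp (h i)` for entire functions `h i`. So at every point of the plane
at least `n + 1` of the `2n + 1` harmonic functions `Re (h i)` are within a fixed constant of their
maximum. It is shown that one of them then is within a constant of the maximum on all of `ℂ`. By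
Liouville's theorem all differences `h i - h j` are then constant, hence so are the `L i ∘ G`; by
the compactness estimate `G` is bounded, hence constant.

The statement on harmonic functions combines two facts.

* Rigidity (`exists_forall_norm_le_of_card`). If at every point at least `n + 1` of the holomorphic
  functions `V i` attain the maximum modulus *exactly*, then one of them attains it everywhere: any
  two sets of `n + 1` indices meet, so the maximum over one open set is the analytic continuation of
  the maximum over another. Normal families turn this into a statement with an error term
  (`exists_eps_forall_norm_le`).
* Rescaling (`exists_not_hasLeader_and_forall_half`). If, for a large constant `M`, some disc admits
  no index within `M` of the maximum, there is a disc `D` of the same kind such that all discs of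
  half its radius centred in `2D` do admit one. Harnack's inequality
  (`exists_hasLeader_of_forall_half`) then bounds all `Re (h i - h j)` on `2D` by a fixed multiple
  of `M`, for a suitable `j`. Applying rigidity to the functions `exp ((h i - h j) / M)`, rescaled
  from `2D` to a fixed disc, gives an index within `M` of the maximum on `D`, a contradiction.
-/

open Metric Filter Set Topology

namespace HolCurve

/-! ### Normal families and rigidity of the maximum modulus -/

/-- **Montel's theorem**, in ultrafilter form. -/
theorem exists_tendstoLocallyUniformlyOn_of_bounded (𝓤 : Ultrafilter ℕ) {U : Set ℂ}
    (hU : IsOpen U) {F : ℕ → ℂ → ℂ} {B : ℝ} (hF : ∀ k, DifferentiableOn ℂ (F k) U)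
    (hB : ∀ k, ∀ z ∈ U, ‖F k z‖ ≤ B) :
    ∃ G : ℂ → ℂ, DifferentiableOn ℂ G U ∧ TendstoLocallyUniformlyOn F G 𝓤 U := by
  have hlim : ∀ z : ℂ, ∃ w : ℂ, z ∈ U → Tendsto (fun k => F k z) 𝓤 (𝓝 w) := by
    intro z
    by_cases hz : z ∈ U
    · obtain ⟨w, -, hw⟩ := (isCompact_closedBall (0 : ℂ) B).ultrafilter_le_nhds
        (𝓤.map fun k => F k z)
        (by
          rw [le_principal_iff]
          exact Filter.mem_map.2 (Eventually.of_forall fun k => by simpa using hB k z hz))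
      exact ⟨w, fun _ => hw⟩
    · exact ⟨0, fun h => absurd h hz⟩
  choose G hG using hlim
  suffices hloc : TendstoLocallyUniformlyOn F G 𝓤 U from
    ⟨G, hloc.differentiableOn (Eventually.of_forall hF) hU, hloc⟩
  rw [Metric.tendstoLocallyUniformlyOn_iff]
  intro ε hε x hx
  obtain ⟨ρ, hρ, hρU⟩ := Metric.isOpen_iff.1 hU x hx
  -- By the Schwarz lemma the family is uniformly Lipschitz near `x`.
  have hlip : ∀ k, ∀ y ∈ ball x ρ, dist (F k y) (F k x) ≤ 2 * B / ρ * dist y x := by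
    intro k y hy
    refine Complex.dist_le_div_mul_dist_of_mapsTo_ball ((hF k).mono hρU) (fun w hw => ?_) hy
    rw [mem_closedBall, dist_eq_norm]
    linarith [norm_sub_le (F k w) (F k x), hB k w (hρU hw), hB k x hx]
  have hlipG : ∀ y ∈ ball x ρ, dist (G y) (G x) ≤ 2 * B / ρ * dist y x := fun y hy =>
    le_of_tendsto ((hG y (hρU hy)).dist (hG x hx)) (Eventually.of_forall fun k => hlip k y hy)
  have hsmall : ∀ᶠ y in 𝓝 x, 2 * B / ρ * dist y x < ε / 3 := by
    have : Tendsto (fun y => 2 * B / ρ * dist y x) (𝓝 x) (𝓝 (2 * B / ρ * dist x x)) :=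
      (continuous_const.mul (continuous_id.dist continuous_const)).tendsto x
    rw [dist_self, mul_zero] at this
    exact this.eventually_lt_const (by positivity)
  refine ⟨{y | 2 * B / ρ * dist y x < ε / 3} ∩ ball x ρ,
    mem_nhdsWithin_of_mem_nhds (inter_mem hsmall (ball_mem_nhds x hρ)), ?_⟩
  filter_upwards [Metric.tendsto_nhds.1 (hG x hx) (ε / 3) (by positivity)] with k hk y hy
  have h1 := hlip k y hy.2
  have h2 := hlipG y hy.2
  have h3 : 2 * B / ρ * dist y x < ε / 3 := hy.1
  have h4 := dist_triangle4 (G y) (G x) (F k x) (F k y)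
  rw [dist_comm (G x) (F k x), dist_comm (F k x) (F k y)] at h4
  linarith

/-- If two holomorphic functions on a connected open set have equal moduli near one point, where
they do not vanish, then they have equal moduli throughout. -/
theorem norm_eq_of_eventually_norm_eq {U : Set ℂ} (hU : IsOpen U) (hc : IsPreconnected U)
    {f g : ℂ → ℂ} (hf : DifferentiableOn ℂ f U) (hg : DifferentiableOn ℂ g U) {z₀ : ℂ}
    (hz₀ : z₀ ∈ U) (h₀ : g z₀ ≠ 0) (h : ∀ᶠ z in 𝓝 z₀, ‖f z‖ = ‖g z‖) :
    ∀ z ∈ U, ‖f z‖ = ‖g z‖ := by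
  have hgc : ContinuousAt g z₀ := hg.continuousOn.continuousAt (hU.mem_nhds hz₀)
  have hne : ∀ᶠ z in 𝓝 z₀, g z ≠ 0 := hgc.eventually_ne h₀
  have hUe : ∀ᶠ z in 𝓝 z₀, z ∈ U := hU.mem_nhds hz₀
  have hd : ∀ᶠ z in 𝓝 z₀, DifferentiableAt ℂ (fun z => f z / g z) z := by
    filter_upwards [hUe, hne] with z hz hz'
    exact (hf.differentiableAt (hU.mem_nhds hz)).div (hg.differentiableAt (hU.mem_nhds hz)) hz'
  have hone : ∀ᶠ z in 𝓝 z₀, ‖f z / g z‖ = 1 := by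
    filter_upwards [h, hne] with z hz hz'
    rw [norm_div, hz, div_self (norm_ne_zero_iff.2 hz')]
  have hmax : IsLocalMax (norm ∘ fun z => f z / g z) z₀ := by
    filter_upwards [hone] with z hz
    simp only [Function.comp_apply]
    rw [hz, hone.self_of_nhds]
  have hconst := Complex.eventually_eq_of_isLocalMax_norm hd hmax
  have hfg : f =ᶠ[𝓝 z₀] fun z => (f z₀ / g z₀) * g z := by
    filter_upwards [hconst, hne] with z hz hz'
    rw [← hz, div_mul_cancel₀ _ hz']
  have hEq := (hf.analyticOnNhd hU).eqOn_of_preconnected_of_eventuallyEq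
    ((hg.const_mul (f z₀ / g z₀)).analyticOnNhd hU) hc hz₀ hfg
  intro z hz
  rw [hEq hz, norm_mul, hone.self_of_nhds, one_mul]

/-- If at every point of a connected open set at least `n + 1` out of at most `2n + 1` holomorphic
functions attain the maximum modulus of the family, then one of them attains it everywhere.
Two sets of `n + 1` indices meet, so the maximum is analytically continued by a common member. -/
theorem exists_forall_norm_le_of_card {ι : Type*} [Fintype ι] {n : ℕ}
    (hι : Fintype.card ι ≤ 2 * n + 1) {U : Set ℂ} (hU : IsOpen U) (hc : IsPreconnected U)
    (hne : U.Nonempty) {V : ι → ℂ → ℂ} (hV : ∀ i, DifferentiableOn ℂ (V i) U)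
    (hpos : ∀ z ∈ U, ∃ i, V i z ≠ 0)
    (hcard : ∀ z ∈ U, ∃ I : Finset ι, I.card = n + 1 ∧ ∀ i ∈ I, ∀ k, ‖V k z‖ ≤ ‖V i z‖) :
    ∃ i, ∀ z ∈ U, ∀ k, ‖V k z‖ ≤ ‖V i z‖ := by
  classical
  -- The set where all members of `I` attain the maximum, closed in `U`. Finitely many such sets
  -- cover `U`, so their interiors are dense.
  let A : {I : Finset ι // I.card = n + 1} → Set U :=
    fun I => {z | ∀ i ∈ I.1, ∀ k, ‖V k z‖ ≤ ‖V i z‖}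
  have hcont : ∀ i, Continuous fun z : U => ‖V i z‖ := fun i =>
    (continuousOn_iff_continuous_domRestrict.1 (hV i).continuousOn).norm
  have hclosed : ∀ I, IsClosed (A I) := by
    intro I
    simp only [A, ofPred_forall]
    exact isClosed_iInter fun i => isClosed_iInter fun _ => isClosed_iInter fun k =>
      isClosed_le (hcont k) (hcont i)
  have hcover : ⋃ I, A I = univ := by
    refine eq_univ_of_forall fun z => ?_
    obtain ⟨I, hI, h⟩ := hcard z z.2
    exact mem_iUnion.2 ⟨⟨I, hI⟩, h⟩
  have hbaire : BaireSpace U := by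
    have := hU.locallyCompactSpace
    infer_instance
  have hdense := dense_iUnion_interior_of_closed hclosed hcover
  have : Nonempty U := hne.to_subtype
  obtain ⟨z₀, hz₀⟩ := hdense.nonempty
  obtain ⟨I, hI⟩ := mem_iUnion.1 hz₀
  obtain ⟨m, hm⟩ : I.1.Nonempty := Finset.card_pos.1 (by rw [I.2]; omega)
  have hclosed' : IsClosed {z : U | ∀ k, ‖V k z‖ ≤ ‖V m z‖} := by
    simp only [ofPred_forall]
    exact isClosed_iInter fun k => isClosed_le (hcont k) (hcont m)
  refine ⟨m, fun z hz => ?_⟩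
  suffices hsub : (⋃ J, interior (A J)) ⊆ {z : U | ∀ k, ‖V k z‖ ≤ ‖V m z‖} from
    (hclosed'.closure_subset_iff.2 hsub) (hdense ⟨z, hz⟩)
  intro z hz
  obtain ⟨J, hJ⟩ := mem_iUnion.1 hz
  obtain ⟨i, hi⟩ : (I.1 ∩ J.1).Nonempty := by
    rw [← Finset.card_pos]
    have h1 := Finset.card_union_add_card_inter I.1 J.1
    have h2 := Finset.card_le_univ (I.1 ∪ J.1)
    rw [I.2, J.2] at h1
    omega
  rw [Finset.mem_inter] at hi
  have hev : ∀ᶠ w in 𝓝 (z₀ : ℂ), ‖V i w‖ = ‖V m w‖ := by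
    have h1 : ∀ᶠ w in 𝓝 z₀, ‖V i (w : U)‖ = ‖V m (w : U)‖ := by
      filter_upwards [mem_interior_iff_mem_nhds.1 hI] with w hw
      exact le_antisymm (hw m hm i) (hw i hi.1 m)
    rw [← map_nhds_subtype_coe_eq_nhds z₀.2 (hU.mem_nhds z₀.2)]
    exact h1
  have hm0 : V m z₀ ≠ 0 := by
    obtain ⟨k, hk⟩ := hpos z₀ z₀.2
    rw [← norm_pos_iff] at hk ⊢
    exact hk.trans_le (interior_subset hI m hm k)
  intro k
  rw [← norm_eq_of_eventually_norm_eq hU hc (hV i) (hV m) z₀.2 hm0 hev z z.2]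
  exact interior_subset hJ i hi.2 k

/-- Quantitative form of `exists_forall_norm_le_of_card`, obtained from it by compactness. -/
theorem exists_eps_forall_norm_le (ι : Type*) [Fintype ι] {n : ℕ}
    (hι : Fintype.card ι ≤ 2 * n + 1) (B : ℝ) :
    ∃ ε > 0, ∀ V : ι → ℂ → ℂ, (∀ i, DifferentiableOn ℂ (V i) (ball 0 2)) →
      (∀ i, ∀ z ∈ ball (0 : ℂ) 2, ‖V i z‖ ≤ B) →
      (∀ z ∈ ball (0 : ℂ) 2, ∃ i, 1 ≤ ‖V i z‖) →
      (∀ z ∈ ball (0 : ℂ) 2, ∃ I : Finset ι, I.card = n + 1 ∧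
        ∀ i ∈ I, ∀ k, ‖V k z‖ ≤ (1 + ε) * ‖V i z‖) →
      ∃ i, ∀ z ∈ closedBall (0 : ℂ) 1, ∀ k, ‖V k z‖ ≤ 2 * ‖V i z‖ := by
  classical
  by_contra! hcon
  choose V hV hB hpos hcard hbad using fun m : ℕ =>
    hcon (1 / ((m : ℝ) + 1)) Nat.one_div_pos_of_nat
  have : Nonempty ι := ⟨(hpos 0 0 (by simp)).choose⟩
  choose! j hj using hpos
  choose! I hIcard hI using hcard
  choose p hp q hq using hbad
  set 𝓤 : Ultrafilter ℕ := hyperfilter ℕ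
  have heps : Tendsto (fun m : ℕ => 1 / ((m : ℝ) + 1)) 𝓤 (𝓝 0) :=
    tendsto_one_div_add_atTop_nhds_zero_nat.mono_left Nat.hyperfilter_le_atTop
  choose W hW hVW using fun i => exists_tendstoLocallyUniformlyOn_of_bounded 𝓤
    (isOpen_ball (x := (0 : ℂ)) (ε := 2)) (fun m => hV m i) (fun m => hB m i)
  have hpt : ∀ i, ∀ z ∈ ball (0 : ℂ) 2, Tendsto (fun m => ‖V m i z‖) 𝓤 (𝓝 ‖W i z‖) :=
    fun i z hz => ((hVW i).tendsto_at hz).norm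
  -- Functions into a finite type are constant on a set of the ultrafilter.
  have hpure : ∀ {α : Type _} [Finite α] (g : ℕ → α), ∃ a, ∀ᶠ m in (𝓤 : Filter ℕ), g m = a := by
    intro α _ g
    obtain ⟨a, ha⟩ := (𝓤.map g).eq_pure_of_finite
    refine ⟨a, ?_⟩
    have : {a} ∈ 𝓤.map g := by rw [ha]; exact mem_pure.2 rfl
    exact this
  obtain ⟨i, hi⟩ := exists_forall_norm_le_of_card hι isOpen_ball
    (convex_ball (0 : ℂ) 2).isPreconnected ⟨0, by simp⟩ hW
    (by
      intro z hz
      obtain ⟨a, ha⟩ := hpure fun m => j m z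
      refine ⟨a, norm_pos_iff.1 (zero_lt_one.trans_le (ge_of_tendsto (hpt a z hz) ?_))⟩
      filter_upwards [ha] with m hm
      exact hm ▸ hj m z hz)
    (by
      intro z hz
      obtain ⟨J, hJ⟩ := hpure fun m => I m z
      refine ⟨J, ?_, fun a ha k => ?_⟩
      · obtain ⟨m, hm⟩ := hJ.exists
        exact hm ▸ hIcard m z hz
      · have h1 : Tendsto (fun m : ℕ => (1 + 1 / ((m : ℝ) + 1)) * ‖V m a z‖) 𝓤
            (𝓝 ((1 + 0) * ‖W a z‖)) := (heps.const_add 1).mul (hpt a z hz)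
        rw [add_zero, one_mul] at h1
        refine le_of_tendsto_of_tendsto (hpt k z hz) h1 ?_
        filter_upwards [hJ] with m hm
        exact hI m z hz a (hm ▸ ha) k)
  -- The points at which the `i`-th function falls short accumulate at a point `x`.
  obtain ⟨x, hx, hpx⟩ := (isCompact_closedBall (0 : ℂ) 1).ultrafilter_le_nhds
    (𝓤.map fun m => p m i)
    (by
      rw [le_principal_iff]
      exact Filter.mem_map.2 (Eventually.of_forall fun m => hp m i))
  have hpx' : Tendsto (fun m => p m i) 𝓤 (𝓝 x) := hpx
  have hx2 : x ∈ ball (0 : ℂ) 2 := closedBall_subset_ball (by norm_num) hx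
  have hpx2 : Tendsto (fun m => p m i) 𝓤 (𝓝[ball 0 2] x) :=
    tendsto_nhdsWithin_iff.2 ⟨hpx', Eventually.of_forall fun m =>
      closedBall_subset_ball (by norm_num) (hp m i)⟩
  obtain ⟨k, hk⟩ := hpure fun m => q m i
  have hlim : ∀ l, Tendsto (fun m => ‖V m l (p m i)‖) 𝓤 (𝓝 ‖W l x‖) := fun l =>
    ((hVW l).tendsto_comp ((hW l).continuousOn x hx2) hx2 hpx2).norm
  have hle : 2 * ‖W i x‖ ≤ ‖W k x‖ := by
    refine le_of_tendsto_of_tendsto ((hlim i).const_mul 2) (hlim k) ?_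
    filter_upwards [hk] with m hm
    exact (hm ▸ hq m i).le
  have hW1 : 1 ≤ ‖W i x‖ := by
    obtain ⟨a, ha⟩ := hpure fun m => j m x
    refine le_trans (ge_of_tendsto (hpt a x hx2) ?_) (hi x hx2 a)
    filter_upwards [ha] with m hm
    exact hm ▸ hj m x hx2
  linarith [hi x hx2 k]

/-! ### Harmonic functions most of which are nearly maximal -/

/-- **Harnack's inequality** on a disc of half the radius. -/
theorem re_le_three_mul_of_nonneg {H : ℂ → ℂ} {b : ℂ} {R S : ℝ} (hR : 0 < R) (hS : 0 < S)
    (hH : DifferentiableOn ℂ H (ball b R)) (hnn : ∀ z ∈ ball b R, 0 ≤ (H z).re)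
    (hb : (H b).re ≤ S) {z : ℂ} (hz : dist z b ≤ R / 2) : (H z).re ≤ 3 * S := by
  have hmaps : ∀ w ∈ ball (0 : ℂ) R, b + w ∈ ball b R := fun w hw => by simpa using hw
  have hzb : ‖z - b‖ ≤ R / 2 := by rwa [← dist_eq_norm]
  have hz' : z - b ∈ ball (0 : ℂ) R := by
    rw [mem_ball_zero_iff]; linarith
  have hd : DifferentiableOn ℂ (fun w => H b - H (b + w)) (ball 0 R) :=
    (hH.comp (by fun_prop) hmaps).const_sub (H b)
  have key := Complex.borelCaratheodory_zero hS hd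
    (fun w hw => by
      have := hnn _ (hmaps w hw)
      simp only [mem_ofPred_eq, Complex.sub_re]
      linarith) hR hz' (by simp)
  rw [add_sub_cancel] at key
  have h2 : 2 * S * ‖z - b‖ / (R - ‖z - b‖) ≤ 2 * S := by
    rw [div_le_iff₀ (by linarith)]
    nlinarith
  have h3 := (Complex.abs_re_le_norm _).trans (key.trans h2)
  rw [Complex.sub_re, abs_le] at h3
  linarith [h3.1]

/-- On the set `s`, the function `Re (h j)` is within `M` of the maximum of all `Re (h i)`, for
a single index `j`. -/
def HasLeader {ι : Type*} (h : ι → ℂ → ℂ) (M : ℝ) (s : Set ℂ) : Prop :=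
  ∃ j, ∀ z ∈ s, ∀ i, (h i z).re ≤ (h j z).re + M

theorem HasLeader.mono {ι : Type*} {h : ι → ℂ → ℂ} {M : ℝ} {s t : Set ℂ}
    (ht : HasLeader h M t) (hst : s ⊆ t) : HasLeader h M s :=
  ht.imp fun _ hj z hz => hj z (hst hz)

theorem exists_hasLeader_closedBall {ι : Type*} [Finite ι] [Nonempty ι] {h : ι → ℂ → ℂ}
    (hh : ∀ i, Differentiable ℂ (h i)) {M : ℝ} (hM : 0 < M) (a : ℂ) :
    ∃ ρ > 0, HasLeader h M (closedBall a ρ) := by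
  obtain ⟨j, hj⟩ := Finite.exists_max fun i => (h i a).re
  have hev : ∀ᶠ z in 𝓝 a, ∀ i, (h i z).re < (h j z).re + M := by
    refine eventually_all.2 fun i => ?_
    have hc : ∀ l, ContinuousAt (fun z => (h l z).re) a := fun l =>
      (Complex.continuous_re.comp (hh l).continuous).continuousAt
    exact (hc i).eventually_lt ((hc j).add continuousAt_const) (by linarith [hj i])
  obtain ⟨ρ, hρ, hsub⟩ := nhds_basis_closedBall.mem_iff.1 hev
  exact ⟨ρ, hρ, j, fun z hz i => (hsub hz i).le⟩

/-- Rescaling: if some disc has no leader, then there is a disc without leader such that all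
discs of half its radius centred in its double do have a leader. Otherwise discs without leader of
geometrically decreasing radii would shrink to a point. -/
theorem exists_not_hasLeader_and_forall_half {ι : Type*} [Finite ι] [Nonempty ι] {h : ι → ℂ → ℂ}
    (hh : ∀ i, Differentiable ℂ (h i)) {M : ℝ} (hM : 0 < M) {c : ℂ} {R : ℝ} (hR : 0 < R)
    (hc : ¬ HasLeader h M (closedBall c R)) :
    ∃ a : ℂ, ∃ r > 0, ¬ HasLeader h M (closedBall a r) ∧
      ∀ b, dist b a ≤ 2 * r → HasLeader h M (closedBall b (r / 2)) := by
  by_contra! hcon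
  have step : ∀ p : {p : ℂ × ℝ // 0 < p.2 ∧ ¬ HasLeader h M (closedBall p.1 p.2)},
      ∃ q : {p : ℂ × ℝ // 0 < p.2 ∧ ¬ HasLeader h M (closedBall p.1 p.2)},
        dist p.1.1 q.1.1 ≤ 2 * p.1.2 ∧ q.1.2 = p.1.2 / 2 := by
    rintro ⟨⟨a, r⟩, hr, hp⟩
    obtain ⟨b, hb, hb'⟩ := hcon a r hr hp
    exact ⟨⟨(b, r / 2), half_pos hr, hb'⟩, by rwa [dist_comm], rfl⟩
  choose next hdist hrad using step
  let u := fun k : ℕ => next^[k] ⟨(c, R), hR, hc⟩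
  have hu : ∀ k, u (k + 1) = next (u k) := fun k => Function.iterate_succ_apply' _ _ _
  have hr : ∀ k, (u k).1.2 = R / 2 ^ k := by
    intro k
    induction k with
    | zero => simp [u]
    | succ k ih => rw [hu, hrad, ih, pow_succ]; field_simp
  have hd : ∀ k, dist (u k).1.1 (u (k + 1)).1.1 ≤ 4 * R / 2 / 2 ^ k := by
    intro k
    rw [hu]
    refine (hdist _).trans_eq ?_
    rw [hr]
    ring
  obtain ⟨x, hx⟩ := cauchySeq_tendsto_of_complete (cauchySeq_of_le_geometric_two hd)
  obtain ⟨ρ, hρ, hlead⟩ := exists_hasLeader_closedBall hh hM x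
  have hr0 : Tendsto (fun k : ℕ => R / 2 ^ k) atTop (𝓝 0) :=
    tendsto_const_nhds.div_atTop (tendsto_pow_atTop_atTop_of_one_lt one_lt_two)
  obtain ⟨k, hk1, hk2⟩ := ((hr0.eventually_lt_const (half_pos hρ)).and
    (Metric.tendsto_nhds.1 hx (ρ / 2) (half_pos hρ))).exists
  refine (u k).2.2 (hlead.mono (closedBall_subset_closedBall' ?_))
  rw [hr]
  linarith

/-- If all discs of radius `r / 2` centred in the disc of radius `2 * r` have a leader, then so has
the whole disc, with an absolutely bounded loss. Leaders of overlapping discs are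
compared by Harnack's inequality, along a chain of eight steps from the centre. -/
theorem exists_hasLeader_of_forall_half :
    ∃ B > 0, ∀ {ι : Type*} (h : ι → ℂ → ℂ), (∀ i, Differentiable ℂ (h i)) →
      ∀ {M : ℝ}, 0 < M → ∀ {a : ℂ} {r : ℝ}, 0 < r →
      (∀ b, dist b a ≤ 2 * r → HasLeader h M (closedBall b (r / 2))) →
      HasLeader h (B * M) (ball a (2 * r)) := by
  -- The loss after `k` steps.
  obtain ⟨β, hβ0, hβ⟩ : ∃ β : ℕ → ℝ, β 0 = 1 ∧ ∀ k, β (k + 1) = 3 * (1 + β k) :=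
    ⟨fun k => Nat.rec 1 (fun _ x => 3 * (1 + x)) k, rfl, fun _ => rfl⟩
  have hβpos : ∀ k, 0 < β k := by
    intro k
    induction k with
    | zero => rw [hβ0]; exact one_pos
    | succ k ih => rw [hβ]; positivity
  refine ⟨β 8, hβpos 8, fun {ι} h hh {M} hM {a r} hr hlead => ?_⟩
  obtain ⟨j, hj⟩ := hlead a (by rw [dist_self]; positivity)
  refine ⟨j, fun z hz => ?_⟩
  have hza : ‖z - a‖ < 2 * r := by rwa [mem_ball, dist_eq_norm] at hz
  have main : ∀ k : ℕ, k ≤ 8 → ∀ i,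
      (h i (a + (k / 8 : ℂ) * (z - a))).re ≤ (h j (a + (k / 8 : ℂ) * (z - a))).re + β k * M := by
    intro k
    induction k with
    | zero =>
      intro _ i
      have := hj a (mem_closedBall_self (by positivity)) i
      simpa [hβ0] using this
    | succ k ih =>
      intro hk8 i
      set b : ℂ := a + (k / 8 : ℂ) * (z - a) with hbdef
      set b' : ℂ := a + (((k + 1 : ℕ) : ℂ) / 8) * (z - a) with hbdef'
      have hk : (k : ℝ) ≤ 8 := by exact_mod_cast (by omega : k ≤ 8)
      have hba : dist b a ≤ 2 * r := by
        rw [dist_eq_norm, hbdef, add_sub_cancel_left, norm_mul, norm_div, Complex.norm_natCast]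
        have h8 : ‖(8 : ℂ)‖ = 8 := by norm_num
        rw [h8]
        nlinarith [norm_nonneg (z - a), (Nat.cast_nonneg k : (0 : ℝ) ≤ k)]
      have hbb : dist b' b ≤ r / 2 / 2 := by
        have : b' - b = (1 / 8 : ℂ) * (z - a) := by
          rw [hbdef, hbdef']; push_cast; ring
        rw [dist_eq_norm, this, norm_mul]
        have h8 : ‖(1 / 8 : ℂ)‖ = 1 / 8 := by norm_num
        rw [h8]
        linarith
      obtain ⟨l, hl⟩ := hlead b hba
      have hb1 := ih (by omega) l
      have hnn : ∀ w ∈ ball b (r / 2), 0 ≤ ((fun w => h l w - h j w + (M : ℂ)) w).re := by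
        intro w hw
        have := hl w (ball_subset_closedBall hw) j
        simp only [Complex.add_re, Complex.sub_re, Complex.ofReal_re]
        linarith
      have hhar := re_le_three_mul_of_nonneg (S := (1 + β k) * M) (half_pos hr)
        (mul_pos (by linarith [hβpos k]) hM)
        (((hh l).sub (hh j)).add_const (M : ℂ)).differentiableOn hnn
        (by
          simp only [Pi.sub_apply, Complex.add_re, Complex.sub_re, Complex.ofReal_re]
          linarith) hbb
      have hb2 := hl b' (mem_closedBall.2 (by linarith)) i
      simp only [Pi.sub_apply, Complex.add_re, Complex.sub_re, Complex.ofReal_re] at hhar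
      rw [hβ]
      linarith
  intro i
  have := main 8 le_rfl i
  norm_num at this
  exact this

/-- If at every point at least `n + 1` of at most `2n + 1` harmonic functions `Re (h i)` are within
`C` of their maximum, then discs have a leader, with a bound independent of the disc. -/
theorem exists_forall_hasLeader_closedBall {ι : Type*} [Fintype ι] [Nonempty ι] {n : ℕ}
    (hι : Fintype.card ι ≤ 2 * n + 1) {h : ι → ℂ → ℂ} (hh : ∀ i, Differentiable ℂ (h i)) (C : ℝ)
    (hcard : ∀ z, ∃ I : Finset ι, I.card = n + 1 ∧
      ∀ i ∈ I, ∀ k, (h k z).re ≤ (h i z).re + C) :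
    ∃ M, ∀ R > 0, HasLeader h M (closedBall 0 R) := by
  obtain ⟨B, hB, hchain⟩ := exists_hasLeader_of_forall_half
  obtain ⟨ε, hε, hrigid⟩ := exists_eps_forall_norm_le ι hι (Real.exp B)
  -- `M` is so large that the error `C` is negligible after division by `M`.
  obtain ⟨M, hM, hMC⟩ : ∃ M > 0, C / M ≤ Real.log (1 + ε) := by
    have hlog : 0 < Real.log (1 + ε) := Real.log_pos (by linarith)
    refine ⟨(|C| + 1) / Real.log (1 + ε), by positivity, ?_⟩
    rw [div_le_iff₀ (by positivity), mul_div_cancel₀ _ hlog.ne']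
    linarith [le_abs_self C]
  refine ⟨M, fun R hR => ?_⟩
  by_contra hno
  obtain ⟨a, r, hr, hno', hhalf⟩ := exists_not_hasLeader_and_forall_half hh hM hR hno
  obtain ⟨j, hj⟩ := hchain h hh hM hr hhalf
  have hmaps : ∀ z ∈ ball (0 : ℂ) 2, a + r * z ∈ ball a (2 * r) := by
    intro z hz
    rw [mem_ball_zero_iff] at hz
    rw [mem_ball, dist_eq_norm, add_sub_cancel_left, norm_mul, Complex.norm_real,
      Real.norm_of_nonneg hr.le]
    nlinarith
  have hnorm : ∀ i z, ‖Complex.exp ((h i (a + r * z) - h j (a + r * z)) / M)‖ =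
      Real.exp (((h i (a + r * z)).re - (h j (a + r * z)).re) / M) := by
    intro i z
    rw [Complex.norm_exp, Complex.div_ofReal_re, Complex.sub_re]
  obtain ⟨i, hi⟩ := hrigid (fun i z => Complex.exp ((h i (a + r * z) - h j (a + r * z)) / M))
    (by
      intro i
      have h1 := hh i
      have h2 := hh j
      fun_prop)
    (by
      intro i z hz
      rw [hnorm, Real.exp_le_exp, div_le_iff₀ hM]
      linarith [hj _ (hmaps z hz) i])
    (fun z _ => ⟨j, by simp⟩)
    (by
      intro z _
      obtain ⟨I, hI, hIle⟩ := hcard (a + r * z)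
      refine ⟨I, hI, fun i hi k => ?_⟩
      rw [hnorm, hnorm, ← Real.exp_log (by linarith : (0 : ℝ) < 1 + ε), ← Real.exp_add,
        Real.exp_le_exp]
      refine le_trans ?_ (add_le_add_left hMC _)
      rw [← add_div]
      gcongr
      linarith [hIle i hi k])
  refine hno' ⟨i, fun z hz k => ?_⟩
  have hr' : (r : ℂ) ≠ 0 := by exact_mod_cast hr.ne'
  have hz1 : (z - a) / r ∈ closedBall (0 : ℂ) 1 := by
    rw [mem_closedBall, dist_eq_norm] at hz
    rw [mem_closedBall_zero_iff, norm_div, Complex.norm_real, Real.norm_of_nonneg hr.le,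
      div_le_one hr]
    exact hz
  have key := hi _ hz1 k
  rw [hnorm, hnorm, mul_div_cancel₀ _ hr', add_sub_cancel] at key
  have h2 : (2 : ℝ) ≤ Real.exp 1 := by linarith [Real.add_one_le_exp (1 : ℝ)]
  have key2 := key.trans (mul_le_mul_of_nonneg_right h2 (Real.exp_pos _).le)
  rw [← Real.exp_add, Real.exp_le_exp, div_le_iff₀ hM, add_mul, div_mul_cancel₀ _ hM.ne'] at key2
  linarith

/-- Under the same hypotheses the differences of the functions `h i` are bounded above in real part
by a common leader, so they are constant modulo `2πi` by Liouville's theorem. -/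
theorem exp_sub_eq_exp_sub_of_card {ι : Type*} [Fintype ι] [Nonempty ι] {n : ℕ}
    (hι : Fintype.card ι ≤ 2 * n + 1) {h : ι → ℂ → ℂ} (hh : ∀ i, Differentiable ℂ (h i)) (C : ℝ)
    (hcard : ∀ z, ∃ I : Finset ι, I.card = n + 1 ∧
      ∀ i ∈ I, ∀ k, (h k z).re ≤ (h i z).re + C) (i k : ι) (z w : ℂ) :
    Complex.exp (h i z - h k z) = Complex.exp (h i w - h k w) := by
  obtain ⟨M, hM⟩ := exists_forall_hasLeader_closedBall hι hh C hcard
  -- One index leads on arbitrarily large discs, hence on the whole plane.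
  obtain ⟨j, hj⟩ : ∃ j, ∀ z i, (h i z).re ≤ (h j z).re + M := by
    choose l hl using fun m : ℕ => hM (m + 1) (by positivity)
    obtain ⟨j, hj⟩ := Finite.exists_infinite_fiber l
    refine ⟨j, fun z i => ?_⟩
    obtain ⟨m, hm, hzm⟩ := (Set.infinite_coe_iff.1 hj).exists_gt ⌈‖z‖⌉₊
    rw [mem_preimage, mem_singleton_iff] at hm
    have := hl m z (by
      rw [mem_closedBall_zero_iff]
      have h1 := Nat.le_ceil ‖z‖
      have h2 : (⌈‖z‖⌉₊ : ℝ) < m := by exact_mod_cast hzm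
      linarith) i
    rwa [hm] at this
  have hconst : ∀ i, Complex.exp (h i z - h j z) = Complex.exp (h i w - h j w) := by
    intro i
    have hd : Differentiable ℂ fun z => Complex.exp (h i z - h j z) :=
      ((hh i).sub (hh j)).cexp
    refine hd.apply_eq_apply_of_bounded ?_ z w
    refine (isBounded_iff_forall_norm_le).2 ⟨Real.exp M, ?_⟩
    rintro _ ⟨x, rfl⟩
    rw [Complex.norm_exp, Real.exp_le_exp, Complex.sub_re]
    linarith [hj x i]
  have hsplit : ∀ x, Complex.exp (h i x - h k x) =
      Complex.exp (h i x - h j x) / Complex.exp (h k x - h j x) := by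
    intro x
    rw [← Complex.exp_sub]
    ring_nf
  rw [hsplit, hsplit, hconst i, hconst k]

/-! ### Projective curves and their entire lifts -/

theorem exists_exp_eq_of_forall_ne_zero {g : ℂ → ℂ} (hg : Differentiable ℂ g)
    (hg0 : ∀ z, g z ≠ 0) : ∃ h : ℂ → ℂ, Differentiable ℂ h ∧ ∀ z, Complex.exp (h z) = g z := by
  have hg' : Differentiable ℂ (deriv g) := by
    have := hg.differentiableOn.deriv (isOpen_univ)
    exact differentiableOn_univ.1 this
  obtain ⟨H, hH⟩ := (hg'.div hg hg0).isExactOn_univ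
  have hH' : ∀ z, HasDerivAt H (deriv g z / g z) z := fun z => hH z (mem_univ z)
  have hdH : Differentiable ℂ H := fun z => (hH' z).differentiableAt
  have hderiv : ∀ z, HasDerivAt (fun z => g z * Complex.exp (-H z)) 0 z := by
    intro z
    have h1 := (hg z).hasDerivAt.mul (hH' z).neg.cexp
    have h2 : deriv g z * Complex.exp ((-H) z) +
        g z * (Complex.exp ((-H) z) * -(deriv g z / g z)) = 0 := by
      field_simp [hg0 z]
      ring
    rwa [h2] at h1
  have hconst : ∀ z, g z * Complex.exp (-H z) = g 0 * Complex.exp (-H 0) := fun z =>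
    is_const_of_deriv_eq_zero (fun w => (hderiv w).differentiableAt) (fun w => (hderiv w).deriv) z 0
  refine ⟨fun z => H z + (Complex.log (g 0) - H 0), hdH.add_const _, fun z => ?_⟩
  rw [Complex.exp_add, sub_eq_add_neg, Complex.exp_add, Complex.exp_log (hg0 0), ← hconst z,
    Complex.exp_neg (H z)]
  field_simp [Complex.exp_ne_zero]

/-- Linear forms without common zero on a projective variety dominate the norm on the cone over
it, since they do so on the unit vectors of the cone, which form a compact set. -/
theorem exists_norm_le_sum_norm {m : ℕ} {κ : Type*} {S : Set (MvPolynomial (Fin (m + 1)) ℂ)}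
    (hS : ∀ P ∈ S, ∃ d : ℕ, P.IsHomogeneous d) (L : κ → Module.Dual ℂ (Fin (m + 1) → ℂ))
    (I : Finset κ) (hI : ∀ p ∈ zeroLocus S, ∃ j ∈ I, p ∉ hyperplane (L j)) :
    ∃ C > 0, ∀ v : Fin (m + 1) → ℂ, (∀ P ∈ S, MvPolynomial.eval v P = 0) →
      ‖v‖ ≤ C * ∑ j ∈ I, ‖L j v‖ := by
  let K : Set (Fin (m + 1) → ℂ) :=
    sphere 0 1 ∩ {v | ∀ P ∈ S, MvPolynomial.eval v P = 0}
  have hK : IsCompact K := by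
    refine (isCompact_sphere 0 1).inter_right ?_
    simp only [ofPred_forall]
    exact isClosed_iInter fun P => isClosed_iInter fun _ =>
      isClosed_eq (MvPolynomial.continuous_eval P) continuous_const
  have hcont : Continuous fun v => ∑ j ∈ I, ‖L j v‖ :=
    continuous_finsetSum _ fun j _ => (L j).continuous_of_finiteDimensional.norm
  obtain ⟨c, hc, hcK⟩ : ∃ c > 0, ∀ v ∈ K, c ≤ ∑ j ∈ I, ‖L j v‖ := by
    rcases K.eq_empty_or_nonempty with h0 | hne
    · exact ⟨1, one_pos, by simp [h0]⟩
    · obtain ⟨v, hv, hmin⟩ := hK.exists_isMinOn hne hcont.continuousOn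
      refine ⟨_, ?_, fun w hw => hmin hw⟩
      have hv0 : v ≠ 0 := by
        rintro rfl
        simpa using hv.1
      obtain ⟨j, hj, hpj⟩ := hI _ ((mk_mem_zeroLocus S hS v hv0).2 hv.2)
      rw [mk_mem_hyperplane] at hpj
      exact Finset.sum_pos' (fun _ _ => norm_nonneg _) ⟨j, hj, norm_pos_iff.2 hpj⟩
  refine ⟨c⁻¹, inv_pos.2 hc, fun v hv => ?_⟩
  rcases eq_or_ne v 0 with rfl | hv0
  · simp
  have hn : 0 < ‖v‖ := norm_pos_iff.2 hv0
  have hmem : ((‖v‖ : ℂ)⁻¹) • v ∈ K := by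
    refine ⟨?_, fun P hP => ?_⟩
    · rw [mem_sphere_zero_iff_norm, norm_smul, norm_inv, Complex.norm_real, norm_norm,
        inv_mul_cancel₀ hn.ne']
    · obtain ⟨d, hd⟩ := hS P hP
      rw [eval_smul_of_isHomogeneous hd, hv P hP, mul_zero]
  have h1 := hcK _ hmem
  simp only [map_smul, norm_smul, norm_inv, Complex.norm_real, norm_norm] at h1
  rw [← Finset.mul_sum, le_inv_mul_iff₀ hn] at h1
  rw [le_inv_mul_iff₀ hc]
  linarith

/-- Out of `2n + 1` functions every `n + 1` of which contain one close to any given one, at least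
`n + 1` are close to the maximum. -/
theorem exists_card_eq_forall_le_add {ι : Type*} [Fintype ι] [Nonempty ι] {n : ℕ}
    (hι : Fintype.card ι = 2 * n + 1) (u : ι → ℝ) (C : ℝ)
    (h : ∀ I : Finset ι, I.card = n + 1 → ∀ k, ∃ j ∈ I, u k ≤ u j + C) :
    ∃ I : Finset ι, I.card = n + 1 ∧ ∀ i ∈ I, ∀ k, u k ≤ u i + C := by
  classical
  let A : Finset ι := Finset.univ.filter fun i => ∀ k, u k ≤ u i + C
  suffices hA : n + 1 ≤ A.card by
    obtain ⟨I, hIA, hI⟩ := Finset.exists_subset_card_eq hA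
    exact ⟨I, hI, fun i hi => (Finset.mem_filter.1 (hIA hi)).2⟩
  by_contra hlt
  have hcompl : n + 1 ≤ Aᶜ.card := by
    rw [Finset.card_compl]
    omega
  obtain ⟨I, hIA, hI⟩ := Finset.exists_subset_card_eq hcompl
  obtain ⟨k, hk⟩ := Finite.exists_max u
  obtain ⟨j, hj, hkj⟩ := h I hI k
  refine Finset.mem_compl.1 (hIA hj) (Finset.mem_filter.2 ⟨Finset.mem_univ j, fun l => ?_⟩)
  exact (hk l).trans hkj

/-- A holomorphic curve omitting the hyperplane `L = 0` has an entire lift on which `L = 1`. -/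
theorem differentiable_inv_smul_rep {m : ℕ} {f : ℂ → ProjSpace m} (hf : IsHolomorphic f)
    (L : Module.Dual ℂ (Fin (m + 1) → ℂ)) (hL : ∀ z, L (f z).rep ≠ 0) :
    Differentiable ℂ fun z => (L (f z).rep)⁻¹ • (f z).rep := by
  intro z₀
  obtain ⟨U, hU, hz₀, F, hF, hfF⟩ := hf z₀
  have hLd : ∀ v, DifferentiableAt ℂ L v := fun v =>
    (LinearMap.toContinuousLinearMap L).differentiableAt
  have heq : ∀ z ∈ U, L (F z) ≠ 0 ∧ (L (f z).rep)⁻¹ • (f z).rep = (L (F z))⁻¹ • F z := by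
    intro z hz
    obtain ⟨h0, hz'⟩ := hfF z hz
    obtain ⟨a, ha⟩ := Projectivization.exists_smul_eq_mk_rep ℂ (F z) h0
    rw [← hz', Units.smul_def] at ha
    have h1 := hL z
    rw [← ha, map_smul, smul_eq_mul] at h1
    refine ⟨right_ne_zero_of_mul h1, ?_⟩
    rw [← ha, map_smul, smul_eq_mul, smul_smul, mul_inv, mul_right_comm,
      inv_mul_cancel₀ a.ne_zero, one_mul]
  have hFd := hF.differentiableAt (hU.mem_nhds hz₀)
  have hd : DifferentiableAt ℂ (fun z => (L (F z))⁻¹ • F z) z₀ :=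
    (((hLd (F z₀)).comp z₀ hFd).inv (heq z₀ hz₀).1).smul hFd
  refine hd.congr_of_eventuallyEq ?_
  filter_upwards [hU.mem_nhds hz₀] with z hz
  exact (heq z hz).2

end HolCurve

theorem theorem1 (m n : ℕ) (M : Set (HolCurve.ProjSpace m))
    (hM : HolCurve.IsProjectiveVariety M)
    (D : Fin (2 * n + 1) → Set (HolCurve.ProjSpace m))
    (hD : ∀ j, HolCurve.IsDivisorOn M (D j))
    (hempty : ∀ I : Finset (Fin (2 * n + 1)), I.card = n + 1 → ⋂ j ∈ I, D j = ∅)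
    (f : ℂ → HolCurve.ProjSpace m) (hf : HolCurve.IsHolomorphic f)
    (hfM : ∀ z, f z ∈ M) (havoid : ∀ j z, f z ∉ D j) :
    ∃ p : HolCurve.ProjSpace m, ∀ z, f z = p := by
  obtain ⟨S, hS, rfl⟩ := hM
  choose L _ hDL using hD
  have hLf : ∀ j z, L j (f z).rep ≠ 0 := fun j z h0 =>
    havoid j z (by rw [hDL]; exact ⟨hfM z, h0⟩)
  -- The entire lift `G` of `f` normalized by `L 0 = 1`, and logarithms of the `L j ∘ G`.
  set G : ℂ → Fin (m + 1) → ℂ := fun z => (L 0 (f z).rep)⁻¹ • (f z).rep with hGdef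
  have hG : Differentiable ℂ G := HolCurve.differentiable_inv_smul_rep hf (L 0) (hLf 0)
  have hLG : ∀ j z, L j (G z) = (L 0 (f z).rep)⁻¹ * L j (f z).rep := fun j z => by
    rw [hGdef, map_smul, smul_eq_mul]
  have hL0G : ∀ z, L 0 (G z) = 1 := fun z => by rw [hLG, inv_mul_cancel₀ (hLf 0 z)]
  have hGcone : ∀ z, ∀ P ∈ S, MvPolynomial.eval (G z) P = 0 := by
    intro z P hP
    obtain ⟨d, hd⟩ := hS P hP
    rw [hGdef, HolCurve.eval_smul_of_isHomogeneous hd, hfM z P hP, mul_zero]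
  have hex : ∀ j, ∃ h : ℂ → ℂ, Differentiable ℂ h ∧ ∀ z, Complex.exp (h z) = L j (G z) := fun j =>
    HolCurve.exists_exp_eq_of_forall_ne_zero
      ((LinearMap.toContinuousLinearMap (L j)).differentiable.comp hG)
      (fun z => by
        have : L j (G z) ≠ 0 := by
          rw [hLG]
          exact mul_ne_zero (inv_ne_zero (hLf 0 z)) (hLf j z)
        exact this)
  choose h hh hexp using hex
  have hre : ∀ j z, Real.exp (h j z).re = ‖L j (G z)‖ := fun j z => by
    rw [← Complex.norm_exp, hexp]
  -- Any `n + 1` of the linear forms control the norm of `G`.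
  have hdom : ∃ A > 0, ∀ I : Finset (Fin (2 * n + 1)), I.card = n + 1 →
      ∀ z, ‖G z‖ ≤ A * ∑ j ∈ I, ‖L j (G z)‖ := by
    have h1 : ∀ I : Finset (Fin (2 * n + 1)), ∃ A > 0, I.card = n + 1 →
        ∀ z, ‖G z‖ ≤ A * ∑ j ∈ I, ‖L j (G z)‖ := by
      intro I
      by_cases hI : I.card = n + 1
      · obtain ⟨A, hA, hle⟩ := HolCurve.exists_norm_le_sum_norm hS L I (by
          intro p hp
          by_contra! hall
          have : p ∈ ⋂ j ∈ I, D j :=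
            mem_iInter₂.2 fun j hj => by rw [hDL]; exact ⟨hp, hall j hj⟩
          rw [hempty I hI] at this
          exact this)
        exact ⟨A, hA, fun _ z => hle _ (hGcone z)⟩
      · exact ⟨1, one_pos, fun h => absurd h hI⟩
    choose A hA hAle using h1
    refine ⟨∑ I, A I, Finset.sum_pos (fun I _ => hA I) Finset.univ_nonempty, fun I hI z => ?_⟩
    refine (hAle I hI z).trans (mul_le_mul_of_nonneg_right ?_ (Finset.sum_nonneg fun _ _ =>
      norm_nonneg _))
    exact Finset.single_le_sum (fun J _ => (hA J).le) (Finset.mem_univ I)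
  obtain ⟨A, hA, hAle⟩ := hdom
  obtain ⟨N, hN, hNle⟩ : ∃ N > 0, ∀ k v, ‖L k v‖ ≤ N * ‖v‖ := by
    refine ⟨1 + ∑ k, ‖LinearMap.toContinuousLinearMap (L k)‖, by positivity, fun k v => ?_⟩
    refine ((LinearMap.toContinuousLinearMap (L k)).le_opNorm v).trans
      (mul_le_mul_of_nonneg_right ?_ (norm_nonneg v))
    have := Finset.single_le_sum
      (f := fun k => ‖LinearMap.toContinuousLinearMap (L k)‖) (fun _ _ => norm_nonneg _)
      (Finset.mem_univ k)
    linarith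
  have hclose : ∀ z, ∀ I : Finset (Fin (2 * n + 1)), I.card = n + 1 → ∀ k, ∃ j ∈ I,
      (h k z).re ≤ (h j z).re + Real.log (N * A * (n + 1)) := by
    intro z I hI k
    obtain ⟨j, hj, hmax⟩ := I.exists_max_image (fun j => ‖L j (G z)‖)
      (Finset.card_pos.1 (by omega))
    refine ⟨j, hj, ?_⟩
    rw [← Real.exp_le_exp, Real.exp_add, Real.exp_log (by positivity), hre, hre]
    have hsum : ∑ l ∈ I, ‖L l (G z)‖ ≤ (n + 1) * ‖L j (G z)‖ := by
      have := Finset.sum_le_card_nsmul I _ _ hmax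
      rw [hI, nsmul_eq_mul] at this
      exact_mod_cast this
    calc ‖L k (G z)‖ ≤ N * ‖G z‖ := hNle k _
      _ ≤ N * (A * ((n + 1) * ‖L j (G z)‖)) := by
          gcongr
          exact (hAle I hI z).trans (by gcongr)
      _ = ‖L j (G z)‖ * (N * A * (n + 1)) := by ring
  have hratio := HolCurve.exp_sub_eq_exp_sub_of_card (n := n) (by simp) hh _ fun z =>
    HolCurve.exists_card_eq_forall_le_add (by simp) (fun i => (h i z).re) _ (hclose z)
  have hLconst : ∀ j z, L j (G z) = L j (G 0) := by
    intro j z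
    have := hratio j 0 z 0
    simpa only [Complex.exp_sub, hexp, hL0G, div_one] using this
  -- So `G` is bounded, hence constant.
  obtain ⟨I, -, hI⟩ := Finset.exists_subset_card_eq
    (show n + 1 ≤ (Finset.univ : Finset (Fin (2 * n + 1))).card by
      rw [Finset.card_univ, Fintype.card_fin]; omega)
  have hGconst : ∀ z, G z = G 0 := by
    intro z
    refine hG.apply_eq_apply_of_bounded ?_ z 0
    refine isBounded_iff_forall_norm_le.2 ⟨A * ∑ j ∈ I, ‖L j (G 0)‖, ?_⟩
    rintro _ ⟨w, rfl⟩
    have := hAle I hI w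
    simpa only [hLconst _ w] using this
  refine ⟨f 0, fun z => ?_⟩
  rw [← (f z).mk_rep, ← (f 0).mk_rep, Projectivization.mk_eq_mk_iff']
  refine ⟨L 0 (f z).rep * (L 0 (f 0).rep)⁻¹, ?_⟩
  have hz : (L 0 (f z).rep)⁻¹ • (f z).rep = (L 0 (f 0).rep)⁻¹ • (f 0).rep := hGconst z
  rw [mul_smul, ← hz, smul_smul, mul_inv_cancel₀ (hLf 0 z), one_smul]
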